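/- For Borel probability measures $\mu,\nu$ on $\mathbb{R}$, let $\mu\triangleright\nu$ denote their monotone convolution, i.e. the distribution of $X+Y$ for monotonically independent random variables $X,Y$ with distributions $\mu,\nu$. Concretely, it is the distribution, in the vector state given by the constant function $1\in L^2(\mathbb{R}^2,\mu\otimes\nu)$, of the sum of the operators $(X\psi)(x,y)=x\int\psi(x,y')\,\nu(dy')$ and $(Y\psi)(x,y)=y\,\psi(x,y)$. Equivalently, it is the unique probability measure with $F_{\mu\triangleright\nu}=F_\mu\circ F_\nu$ on the upper half-plane, where $F_\mu(z)=\left(\int_{\mathbb{R}}\frac{\mu(dt)}{z-t}\right)^{-1}$. For $b>0$ let $D_b\mu(A)=\mu(b^{-1}A)$, and let $m(\mu)$ and $\mathrm{var}(\mu)$ be the mean and the variance of $\mu$. A sequence $(\nu_n)_{n\ge1}$ of Borel probability measures on $\mathbb{R}$ is called stable, with asymptotic constants $a_n\in\mathbb{R}$, if $\lim_{n\to\infty}\nu_n(\{t:|t-a_n|\ge\varepsilon\})=0$ for every $\varepsilon>0$; it is called stable if such constants exist. Theorem. Let $(\mu_n)_{n\ge1}$ be Borel probability measures on $\mathbb{R}$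 with finite variances. (1) If $0<b_1<b_2<\cdots\to\infty$ and $\sum_{k=1}^\infty \mathrm{var}(\mu_k)/b_k^2<\infty$, then the sequence of measures $D_{1/b_n}(\mu_1\triangleright\mu_2\triangleright\cdots\triangleright\mu_n)$, $n\ge1$, is stable, and it is stable with the asymptotic constants $$a_n=\frac1{b_n}\sum_{k=1}^n m(\mu_k).$$ (2) In particular, if $\mu_n=\mu$ for all $n$, then $D_{1/n}(\underbrace{\mu\triangleright\cdots\triangleright\mu}_{n\text{ times}})$ converges weakly to the point mass at $m(\mu)$ as $n\to\infty$. -/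

import Mathlib

open MeasureTheory ProbabilityTheory Filter Topology

noncomputable section

/-- The Cauchy transform `G_μ(z) = ∫ (z - t)⁻¹ μ(dt)`. -/
def cauchyTransform (μ : ProbabilityMeasure ℝ) (z : ℂ) : ℂ :=
  ∫ t, (z - (t : ℂ))⁻¹ ∂(μ : Measure ℝ)

/-- The reciprocal Cauchy transform `F_μ = 1 / G_μ`. -/
def reciprocalCauchyTransform (μ : ProbabilityMeasure ℝ) (z : ℂ) : ℂ :=
  (cauchyTransform μ z)⁻¹

/-- `ρ` is the distribution of the (possibly unbounded) symmetric operator `A` in the vector state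
given by `ω`: for every `z` in the upper half-plane the resolvent equation `(z - A) ψ = ω` has a
solution `ψ` in the domain of `A`, and `⟪ω, (z - A)⁻¹ ω⟫ = ∫ (z - t)⁻¹ ρ(dt)`.  Since
`‖(z - A) ψ‖ ≥ (Im z) ‖ψ‖` for symmetric `A`, the solution is unique, and since a probability
measure is determined by its Cauchy transform, so is `ρ`.  For self-adjoint `A` this `ρ` is the
spectral distribution `B ↦ ⟪ω, 1_B(A) ω⟫`. -/
def HasDistribution {H : Type*} [NormedAddCommGroup H] [InnerProductSpace ℂ H]
    (A : H →ₗ.[ℂ] H) (ω : H) (ρ : ProbabilityMeasure ℝ) : Prop :=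
  ∀ z : ℂ, 0 < z.im → ∃ ψ : A.domain,
    z • (ψ : H) - A ψ = ω ∧ inner ℂ ω (ψ : H) = cauchyTransform ρ z

/-- The Hilbert space `L²(μ) ⊗ L²(ν) = L²(ℝ², μ ⊗ ν)`. -/
abbrev MonotoneSpace (μ ν : ProbabilityMeasure ℝ) : Type :=
  Lp ℂ 2 ((μ : Measure ℝ).prod (ν : Measure ℝ))

/-- The vacuum vector `1 ⊗ 1`. -/
def vacuum (μ ν : ProbabilityMeasure ℝ) : MonotoneSpace μ ν :=
  Lp.const 2 ((μ : Measure ℝ).prod (ν : Measure ℝ)) (1 : ℂ)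

/-- The function `(x, y) ↦ x · ∫ ψ(x, y') ν(dy')`. -/
def leftFun (ν : ProbabilityMeasure ℝ) (ψ : ℝ × ℝ → ℂ) (p : ℝ × ℝ) : ℂ :=
  (p.1 : ℂ) * ∫ y, ψ (p.1, y) ∂(ν : Measure ℝ)

theorem leftFun_add (μ ν : ProbabilityMeasure ℝ) (ψ φ : MonotoneSpace μ ν) :
    leftFun ν (ψ + φ : MonotoneSpace μ ν)
      =ᵐ[(μ : Measure ℝ).prod (ν : Measure ℝ)] leftFun ν ψ + leftFun ν φ := by
  have h1 := Measure.ae_ae_of_ae_prod (Lp.coeFn_add ψ φ)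
  have h2 := ((Lp.memLp ψ).integrable (by norm_num)).prod_right_ae
  have h3 := ((Lp.memLp φ).integrable (by norm_num)).prod_right_ae
  refine Measure.quasiMeasurePreserving_fst.ae (p := fun x : ℝ =>
    (x : ℂ) * ∫ y, (ψ + φ : MonotoneSpace μ ν) (x, y) ∂(ν : Measure ℝ)
      = (x : ℂ) * ∫ y, ψ (x, y) ∂(ν : Measure ℝ) + (x : ℂ) * ∫ y, φ (x, y) ∂(ν : Measure ℝ)) ?_
  filter_upwards [h1, h2, h3] with x h1 h2 h3
  rw [integral_congr_ae h1, ← mul_add, ← integral_add h2 h3]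
  rfl

theorem leftFun_smul (μ ν : ProbabilityMeasure ℝ) (c : ℂ) (ψ : MonotoneSpace μ ν) :
    leftFun ν (c • ψ : MonotoneSpace μ ν)
      =ᵐ[(μ : Measure ℝ).prod (ν : Measure ℝ)] c • leftFun ν ψ := by
  have h1 := Measure.ae_ae_of_ae_prod (Lp.coeFn_smul c ψ)
  refine Measure.quasiMeasurePreserving_fst.ae (p := fun x : ℝ =>
    (x : ℂ) * ∫ y, (c • ψ : MonotoneSpace μ ν) (x, y) ∂(ν : Measure ℝ)
      = c * ((x : ℂ) * ∫ y, ψ (x, y) ∂(ν : Measure ℝ))) ?_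
  filter_upwards [h1] with x h1
  rw [integral_congr_ae h1, mul_left_comm]
  congr 1
  exact integral_const_mul c _

theorem rightFun_add (μ ν : ProbabilityMeasure ℝ) (ψ φ : MonotoneSpace μ ν) :
    (fun p : ℝ × ℝ => (p.2 : ℂ) * (ψ + φ : MonotoneSpace μ ν) p)
      =ᵐ[(μ : Measure ℝ).prod (ν : Measure ℝ)]
        (fun p => (p.2 : ℂ) * ψ p) + fun p => (p.2 : ℂ) * φ p := by
  filter_upwards [Lp.coeFn_add ψ φ] with p h
  rw [h]
  exact mul_add _ _ _

theorem rightFun_smul (μ ν : ProbabilityMeasure ℝ) (c : ℂ) (ψ : MonotoneSpace μ ν) :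
    (fun p : ℝ × ℝ => (p.2 : ℂ) * (c • ψ : MonotoneSpace μ ν) p)
      =ᵐ[(μ : Measure ℝ).prod (ν : Measure ℝ)] c • fun p => (p.2 : ℂ) * ψ p := by
  filter_upwards [Lp.coeFn_smul c ψ] with p h
  rw [h]
  exact mul_left_comm _ _ _

/-- The operator `X = M ⊗ P` on `L²(μ) ⊗ L²(ν)`, where `M` is multiplication by the coordinate
and `P` is the projection onto the constants, on its maximal domain:
`(X ψ)(x, y) = x ∫ ψ(x, y') ν(dy')`.  It has distribution `μ` in the vacuum state. -/
def monotoneLeft (μ ν : ProbabilityMeasure ℝ) : MonotoneSpace μ ν →ₗ.[ℂ] MonotoneSpace μ ν where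
  domain :=
    { carrier := {ψ | MemLp (leftFun ν ψ) 2 ((μ : Measure ℝ).prod (ν : Measure ℝ))}
      add_mem' := fun {ψ φ} hψ hφ =>
        (memLp_congr_ae (leftFun_add μ ν ψ φ)).2 (MemLp.add hψ hφ)
      zero_mem' := by
        have h := leftFun_smul μ ν 0 0
        rw [zero_smul, zero_smul] at h
        exact (memLp_congr_ae h).2 MemLp.zero
      smul_mem' := fun c ψ hψ =>
        (memLp_congr_ae (leftFun_smul μ ν c ψ)).2 (MemLp.const_smul hψ c) }
  toFun :=
    { toFun := fun ψ => MemLp.toLp (leftFun ν ψ.1) ψ.2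
      map_add' := fun ψ φ => by
        rw [← MemLp.toLp_add]
        exact MemLp.toLp_congr _ _ (leftFun_add μ ν ψ φ)
      map_smul' := fun c ψ => by
        rw [RingHom.id_apply, ← MemLp.toLp_const_smul]
        exact MemLp.toLp_congr _ _ (leftFun_smul μ ν c ψ) }

/-- The operator `Y = 1 ⊗ M` on `L²(μ) ⊗ L²(ν)` on its maximal domain: `(Y ψ)(x, y) = y ψ(x, y)`.
It has distribution `ν` in the vacuum state. -/
def monotoneRight (μ ν : ProbabilityMeasure ℝ) : MonotoneSpace μ ν →ₗ.[ℂ] MonotoneSpace μ ν where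
  domain :=
    { carrier := {ψ | MemLp (fun p : ℝ × ℝ => (p.2 : ℂ) * ψ p) 2
        ((μ : Measure ℝ).prod (ν : Measure ℝ))}
      add_mem' := fun {ψ φ} hψ hφ =>
        (memLp_congr_ae (rightFun_add μ ν ψ φ)).2 (MemLp.add hψ hφ)
      zero_mem' := by
        have h := rightFun_smul μ ν 0 0
        rw [zero_smul, zero_smul] at h
        exact (memLp_congr_ae h).2 MemLp.zero
      smul_mem' := fun c ψ hψ =>
        (memLp_congr_ae (rightFun_smul μ ν c ψ)).2 (MemLp.const_smul hψ c) }
  toFun :=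
    { toFun := fun ψ => MemLp.toLp (fun p : ℝ × ℝ => (p.2 : ℂ) * ψ.1 p) ψ.2
      map_add' := fun ψ φ => by
        rw [← MemLp.toLp_add]
        exact MemLp.toLp_congr _ _ (rightFun_add μ ν ψ φ)
      map_smul' := fun c ψ => by
        rw [RingHom.id_apply, ← MemLp.toLp_const_smul]
        exact MemLp.toLp_congr _ _ (rightFun_smul μ ν c ψ) }

/-- `ρ` is the distribution of `X + Y` in the vacuum state, where `X = M ⊗ P` and `Y = 1 ⊗ M` are the
universal realization of monotonically independent random variables with distributions `μ` and
`ν`: since `f(X) = f(M) ⊗ P` when `f 0 = 0`, one has `f(X) g(Y) h(X) = (∫ g dν) f(X) h(X)` when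
`f 0 = h 0 = 0`, and `⟪1, g(Y) f(X) h(Y) 1⟫ = (∫ g dν) (∫ f dμ) (∫ h dν)`. -/
def IsMonotoneConvolution (μ ν ρ : ProbabilityMeasure ℝ) : Prop :=
  HasDistribution (monotoneLeft μ ν + monotoneRight μ ν) (vacuum μ ν) ρ

theorem norm_inv_sub_ofReal_le {z : ℂ} (hz : 0 < z.im) (t : ℝ) :
    ‖(z - (t : ℂ))⁻¹‖ ≤ z.im⁻¹ := by
  rw [norm_inv]
  have h := Complex.abs_im_le_norm (z - (t : ℂ))
  rw [Complex.sub_im, Complex.ofReal_im, sub_zero, abs_of_pos hz] at h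
  exact inv_anti₀ hz h

theorem sub_ofReal_ne_zero {z : ℂ} (hz : 0 < z.im) (t : ℝ) : z - (t : ℂ) ≠ 0 := by
  intro h
  have := congrArg Complex.im h
  simp at this
  exact hz.ne' this

theorem integrable_inv_sub_ofReal (μ : ProbabilityMeasure ℝ) {z : ℂ} (hz : 0 < z.im) :
    Integrable (fun t : ℝ => (z - (t : ℂ))⁻¹) (μ : Measure ℝ) :=
  Integrable.of_bound (by fun_prop) z.im⁻¹ (ae_of_all _ fun t => norm_inv_sub_ofReal_le hz t)

theorem cauchyTransform_im_neg (μ : ProbabilityMeasure ℝ) {z : ℂ} (hz : 0 < z.im) :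
    (cauchyTransform μ z).im < 0 := by
  have hi := integrable_inv_sub_ofReal μ hz
  have h : (cauchyTransform μ z).im = ∫ t, ((z - (t : ℂ))⁻¹).im ∂(μ : Measure ℝ) :=
    (integral_im hi).symm
  have hneg : ∀ t : ℝ, 0 < -((z - (t : ℂ))⁻¹).im := fun t => by
    rw [Complex.inv_im, Complex.sub_im, Complex.ofReal_im, sub_zero, neg_div, neg_neg]
    exact div_pos hz (Complex.normSq_pos.2 (sub_ofReal_ne_zero hz t))
  have hpos : 0 < ∫ t, -((z - (t : ℂ))⁻¹).im ∂(μ : Measure ℝ) := by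
    rw [integral_pos_iff_support_of_nonneg (fun t => (hneg t).le) hi.im.neg]
    rw [show Function.support (fun t : ℝ => -((z - (t : ℂ))⁻¹).im) = Set.univ from
      Set.eq_univ_of_forall fun t => (hneg t).ne']
    simp
  rw [integral_neg] at hpos
  linarith

theorem reciprocalCauchyTransform_im_pos (μ : ProbabilityMeasure ℝ) {z : ℂ} (hz : 0 < z.im) :
    0 < (reciprocalCauchyTransform μ z).im := by
  have h := cauchyTransform_im_neg μ hz
  have h0 : cauchyTransform μ z ≠ 0 := fun h0 => by simp [h0] at h
  rw [reciprocalCauchyTransform, Complex.inv_im]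
  exact div_pos (by linarith) (Complex.normSq_pos.2 h0)

theorem vacuum_ae (μ ν : ProbabilityMeasure ℝ) :
    vacuum μ ν =ᵐ[(μ : Measure ℝ).prod (ν : Measure ℝ)] fun _ => (1 : ℂ) :=
  Lp.coeFn_const 2 _ (1 : ℂ)

theorem inner_vacuum (μ ν : ProbabilityMeasure ℝ) (ψ : MonotoneSpace μ ν) :
    inner ℂ (vacuum μ ν) ψ
      = ∫ x, ∫ y, ψ (x, y) ∂(ν : Measure ℝ) ∂(μ : Measure ℝ) := by
  rw [L2.inner_def, ← integral_prod _ ((Lp.memLp ψ).integrable (by norm_num))]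
  refine integral_congr_ae ?_
  filter_upwards [vacuum_ae μ ν] with p h
  simp [h]

/-- Solving the resolvent equation of `X + Y` in a fibre. -/
theorem inner_vacuum_of_resolvent (μ ν : ProbabilityMeasure ℝ) {z : ℂ} (hz : 0 < z.im)
    (ψ : (monotoneLeft μ ν + monotoneRight μ ν).domain)
    (h : z • (ψ : MonotoneSpace μ ν) - (monotoneLeft μ ν + monotoneRight μ ν) ψ = vacuum μ ν) :
    inner ℂ (vacuum μ ν) (ψ : MonotoneSpace μ ν)
      = cauchyTransform μ (reciprocalCauchyTransform ν z) := by
  rw [inner_vacuum, cauchyTransform]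
  refine integral_congr_ae ?_
  have hF := reciprocalCauchyTransform_im_pos ν hz
  have hG : cauchyTransform ν z ≠ 0 := fun h0 => by
    have := cauchyTransform_im_neg ν hz
    simp [h0] at this
  have hmain : ∀ᵐ p ∂(μ : Measure ℝ).prod (ν : Measure ℝ),
      z * (ψ : MonotoneSpace μ ν) p - (leftFun ν (ψ : MonotoneSpace μ ν) p
        + (p.2 : ℂ) * (ψ : MonotoneSpace μ ν) p) = 1 := by
    have hX := MemLp.coeFn_toLp ψ.2.1
    have hY := MemLp.coeFn_toLp ψ.2.2
    have hXY := Lp.coeFn_add (MemLp.toLp _ ψ.2.1) (MemLp.toLp _ ψ.2.2)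
    have hs := Lp.coeFn_sub (z • (ψ : MonotoneSpace μ ν))
      ((monotoneLeft μ ν + monotoneRight μ ν) ψ)
    rw [h] at hs
    filter_upwards [hX, hY, hXY, hs, Lp.coeFn_smul z (ψ : MonotoneSpace μ ν), vacuum_ae μ ν]
      with p hX hY hXY hs hz1 hv
    rw [hv, Pi.sub_apply, hz1, Pi.smul_apply, smul_eq_mul] at hs
    rw [Pi.add_apply, hX, hY] at hXY
    rw [← hXY]
    exact hs.symm
  filter_upwards [Measure.ae_ae_of_ae_prod hmain] with x hx
  set c : ℂ := ∫ y, (ψ : MonotoneSpace μ ν) (x, y) ∂(ν : Measure ℝ) with hc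
  have hx' : ∀ᵐ y ∂(ν : Measure ℝ), (ψ : MonotoneSpace μ ν) (x, y)
      = (1 + (x : ℂ) * c) * (z - (y : ℂ))⁻¹ := by
    filter_upwards [hx] with y hy
    rw [eq_mul_inv_iff_mul_eq₀ (sub_ofReal_ne_zero hz y)]
    have hl : leftFun ν (ψ : MonotoneSpace μ ν) (x, y) = (x : ℂ) * c := rfl
    rw [hl] at hy
    linear_combination hy
  have hcc : c = (1 + (x : ℂ) * c) * cauchyTransform ν z := by
    rw [cauchyTransform, ← integral_const_mul, ← integral_congr_ae hx']
  have hne := sub_ofReal_ne_zero hF x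
  rw [eq_comm, inv_eq_iff_eq_inv, eq_comm, inv_eq_iff_eq_inv, eq_comm, ← one_div,
    div_eq_iff hne, reciprocalCauchyTransform, mul_sub]
  field_simp
  linear_combination -hcc

/-- The resolvent equation of `X + Y` is solvable for the vacuum vector. -/
theorem exists_resolvent (μ ν : ProbabilityMeasure ℝ) {z : ℂ} (hz : 0 < z.im) :
    ∃ ψ : (monotoneLeft μ ν + monotoneRight μ ν).domain,
      z • (ψ : MonotoneSpace μ ν) - (monotoneLeft μ ν + monotoneRight μ ν) ψ = vacuum μ ν := by
  set F : ℂ := reciprocalCauchyTransform ν z with hFdef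
  have hF : 0 < F.im := reciprocalCauchyTransform_im_pos ν hz
  have hG : cauchyTransform ν z ≠ 0 := fun h0 => by
    have := cauchyTransform_im_neg ν hz
    simp [h0] at this
  have hGF : cauchyTransform ν z * F = 1 := mul_inv_cancel₀ hG
  let f : ℝ × ℝ → ℂ := fun p => F * (F - (p.1 : ℂ))⁻¹ * (z - (p.2 : ℂ))⁻¹
  have hbd : ∀ {w : ℂ}, 0 < w.im → ∀ t : ℝ, ‖(t : ℂ) * (w - (t : ℂ))⁻¹‖ ≤ ‖w‖ * w.im⁻¹ + 1 := by
    intro w hw t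
    have : (t : ℂ) * (w - (t : ℂ))⁻¹ = w * (w - (t : ℂ))⁻¹ - 1 := by
      field_simp [sub_ofReal_ne_zero hw t]
      ring
    rw [this]
    refine (norm_sub_le _ _).trans ?_
    rw [norm_mul, norm_one]
    gcongr
    exact norm_inv_sub_ofReal_le hw t
  have hfm : MemLp f 2 ((μ : Measure ℝ).prod (ν : Measure ℝ)) := by
    refine MemLp.of_bound (by fun_prop) (‖F‖ * F.im⁻¹ * z.im⁻¹) (ae_of_all _ fun p => ?_)
    rw [norm_mul, norm_mul]
    gcongr
    · exact norm_inv_sub_ofReal_le hF p.1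
    · exact norm_inv_sub_ofReal_le hz p.2
  have hleft : leftFun ν (hfm.toLp f) =ᵐ[(μ : Measure ℝ).prod (ν : Measure ℝ)]
      fun p => (p.1 : ℂ) * (F - (p.1 : ℂ))⁻¹ := by
    refine Measure.quasiMeasurePreserving_fst.ae (p := fun x : ℝ =>
      (x : ℂ) * ∫ y, (hfm.toLp f) (x, y) ∂(ν : Measure ℝ) = (x : ℂ) * (F - (x : ℂ))⁻¹) ?_
    filter_upwards [Measure.ae_ae_of_ae_prod (MemLp.coeFn_toLp hfm)] with x hx
    rw [integral_congr_ae hx]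
    have : ∫ y, f (x, y) ∂(ν : Measure ℝ) = F * (F - (x : ℂ))⁻¹ * cauchyTransform ν z := by
      rw [cauchyTransform, ← integral_const_mul]
    rw [this]
    linear_combination (x : ℂ) * (F - (x : ℂ))⁻¹ * hGF
  have hright : (fun p : ℝ × ℝ => (p.2 : ℂ) * (hfm.toLp f) p)
      =ᵐ[(μ : Measure ℝ).prod (ν : Measure ℝ)]
        fun p => F * (F - (p.1 : ℂ))⁻¹ * ((p.2 : ℂ) * (z - (p.2 : ℂ))⁻¹) := by
    filter_upwards [MemLp.coeFn_toLp hfm] with p hp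
    rw [hp]
    simp only [f]
    ring
  have hX : MemLp (leftFun ν (hfm.toLp f)) 2 ((μ : Measure ℝ).prod (ν : Measure ℝ)) := by
    refine (memLp_congr_ae hleft).2 ?_
    exact MemLp.of_bound (by fun_prop) _ (ae_of_all _ fun p => hbd hF p.1)
  have hY : MemLp (fun p : ℝ × ℝ => (p.2 : ℂ) * (hfm.toLp f) p) 2
      ((μ : Measure ℝ).prod (ν : Measure ℝ)) := by
    refine (memLp_congr_ae hright).2 ?_
    refine MemLp.of_bound (by fun_prop) (‖F‖ * F.im⁻¹ * (‖z‖ * z.im⁻¹ + 1))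
      (ae_of_all _ fun p => ?_)
    rw [norm_mul, norm_mul]
    gcongr
    · exact norm_inv_sub_ofReal_le hF p.1
    · exact hbd hz p.2
  refine ⟨⟨hfm.toLp f, hX, hY⟩, ?_⟩
  have hsum : (monotoneLeft μ ν + monotoneRight μ ν) ⟨hfm.toLp f, hX, hY⟩
      = hX.toLp _ + hY.toLp _ := rfl
  rw [hsum]
  refine Lp.ext ?_
  filter_upwards [Lp.coeFn_sub (z • hfm.toLp f) (hX.toLp _ + hY.toLp _),
    Lp.coeFn_smul z (hfm.toLp f), Lp.coeFn_add (hX.toLp _) (hY.toLp _), hX.coeFn_toLp,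
    hY.coeFn_toLp, vacuum_ae μ ν, hleft, hright, hfm.coeFn_toLp]
    with p h1 h2 h3 h4 h5 h6 h7 h8 h9
  rw [h1, h6, Pi.sub_apply, h2, h3, Pi.smul_apply, Pi.add_apply, h4, h5, h7, h8, h9]
  have n1 := sub_ofReal_ne_zero hF p.1
  have n2 := sub_ofReal_ne_zero hz p.2
  simp only [f, smul_eq_mul]
  field_simp
  ring

/-- The operator definition amounts to composition of reciprocal Cauchy transforms. -/
theorem isMonotoneConvolution_iff (μ ν ρ : ProbabilityMeasure ℝ) :
    IsMonotoneConvolution μ ν ρ ↔ ∀ z : ℂ, 0 < z.im →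
      reciprocalCauchyTransform ρ z
        = reciprocalCauchyTransform μ (reciprocalCauchyTransform ν z) := by
  constructor
  · intro h z hz
    obtain ⟨ψ, h1, h2⟩ := h z hz
    rw [inner_vacuum_of_resolvent μ ν hz ψ h1] at h2
    rw [reciprocalCauchyTransform, ← h2]
    rfl
  · intro h z hz
    obtain ⟨ψ, hψ⟩ := exists_resolvent μ ν hz
    refine ⟨ψ, hψ, ?_⟩
    rw [inner_vacuum_of_resolvent μ ν hz ψ hψ]
    exact (inv_injective (h z hz)).symm

/-- The monotone convolution `μ ▷ ν`: the distribution of `X + Y`. -/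
def monotoneConvolution (μ ν : ProbabilityMeasure ℝ) : ProbabilityMeasure ℝ :=
  Classical.epsilon (IsMonotoneConvolution μ ν)

/-- For `μ 0, μ 1, …` standing for `μ₁, μ₂, …`, the value at `n` is `μ₁ ▷ μ₂ ▷ ⋯ ▷ μ_{n+1}`. -/
def iteratedMonotoneConvolution (μ : ℕ → ProbabilityMeasure ℝ) : ℕ → ProbabilityMeasure ℝ
  | 0 => μ 0
  | n + 1 => monotoneConvolution (iteratedMonotoneConvolution μ n) (μ (n + 1))

/-- The dilation `D_b μ (A) = μ (b⁻¹ A)`, the law of `b t` when `t` has law `μ`. -/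
def dilation (b : ℝ) (μ : ProbabilityMeasure ℝ) : ProbabilityMeasure ℝ :=
  μ.map (f := fun t => b * t) (measurable_const_mul b).aemeasurable

/-- The sequence `ν` is stable with asymptotic constants `a`. -/
def IsStableWith (ν : ℕ → ProbabilityMeasure ℝ) (a : ℕ → ℝ) : Prop :=
  ∀ ε : ℝ, 0 < ε →
    Tendsto (fun n => (ν n : Measure ℝ) {t : ℝ | ε ≤ |t - a n|}) atTop (𝓝 0)

/-- The sequence `ν` is stable. -/
def IsStableSequence (ν : ℕ → ProbabilityMeasure ℝ) : Prop :=
  ∃ a : ℕ → ℝ, IsStableWith ν a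

end

/-! Applied to the vacuum, `X` gives the function `x` and `Y` gives `y`, so the second moment of `μ
▷ ν` about `c` should be `‖(X + Y - c) 1‖² = ∫∫ (x + y - c)² dμ dν`, as for independent variables.
With centre `c + m(ν)` the cross term vanishes and `var(ν)` is added to the second moment of `μ`
about `c`. By induction the second moment of `μ₁ ▷ ⋯ ▷ μₙ` about the sum of the means is at most the
sum of the variances. Chebyshev's inequality and Kronecker's lemma (`tendsto_sum_div_sq`) then give
stability, and `bₙ = n` gives the weak law.

The operators may be unbounded, and `monotoneConvolution` is a choice, so existence needs a proof.
Both points are settled by discretization. For images under simple functions `X + Y` is a Hermitian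
matrix, and the spectral theorem yields the law and its exact second moments
(`exists_isMonotoneConvolution_map_simpleFunc`). The Cauchy transforms converge to `G_μ ∘ F_ν`;
tightness supplies a limit law (`exists_isMonotoneConvolution`), and the second moments survive as
an upper bound (`IsMonotoneConvolution.second_moment_le`), which suffices. -/

noncomputable section

/-! ### Finite-dimensional model -/

/-- The spectral distribution of a symmetric operator on a finite-dimensional space in a vector
state, together with its second moments. -/
theorem exists_distribution_of_isSymmetric {E : Type*} [NormedAddCommGroup E]
    [InnerProductSpace ℂ E] [FiniteDimensional ℂ E] {T : E →ₗ[ℂ] E} (hT : T.IsSymmetric)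
    {ω : E} (hω : ‖ω‖ = 1) :
    ∃ ρ : ProbabilityMeasure ℝ,
      (∀ (z : ℂ) (ψ : E), 0 < z.im → z • ψ - T ψ = ω → inner ℂ ω ψ = cauchyTransform ρ z) ∧
      ∀ c : ℝ, Integrable (fun t : ℝ => (t - c) ^ 2) (ρ : Measure ℝ) ∧
        ∫ t, (t - c) ^ 2 ∂(ρ : Measure ℝ) = ‖T ω - (c : ℂ) • ω‖ ^ 2 := by
  let e := hT.eigenvectorBasis rfl
  let l := hT.eigenvalues rfl
  have hTe : ∀ i, T (e i) = ((l i : ℝ) : ℂ) • e i := hT.apply_eigenvectorBasis rfl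
  have hsum : ∀ v : E, ∑ i, ‖inner ℂ (e i) v‖ ^ 2 = ‖v‖ ^ 2 := e.sum_sq_norm_inner_right
  let m : Measure ℝ := ∑ i, ENNReal.ofReal (‖inner ℂ (e i) ω‖ ^ 2) • Measure.dirac (l i)
  have hm : IsProbabilityMeasure m := by
    constructor
    simp only [m, Measure.finsetSum_apply, Measure.smul_apply, measure_univ, smul_eq_mul, mul_one]
    rw [← ENNReal.ofReal_sum_of_nonneg fun i _ => by positivity, hsum, hω]
    simp
  have hint : ∀ {F : Type} [NormedAddCommGroup F] (f : ℝ → F), StronglyMeasurable f →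
      Integrable f m := by
    intro F _ f hf
    refine integrable_finsetSum_measure.2 fun i _ => ?_
    exact (integrable_dirac' hf enorm_lt_top).smul_measure ENNReal.ofReal_ne_top
  have hval : ∀ {F : Type} [NormedAddCommGroup F] [NormedSpace ℝ F] [CompleteSpace F] (f : ℝ → F),
      StronglyMeasurable f → ∫ t, f t ∂m = ∑ i, ‖inner ℂ (e i) ω‖ ^ 2 • f (l i) := by
    intro F _ _ _ f hf
    rw [integral_finsetSum_measure fun i _ => integrable_finsetSum_measure.1 (hint f hf) i (Finset.mem_univ i)]
    refine Finset.sum_congr rfl fun i _ => ?_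
    rw [integral_smul_measure, integral_dirac' _ _ hf, ENNReal.toReal_ofReal (by positivity)]
  refine ⟨⟨m, hm⟩, fun z ψ hz h => ?_, fun c => ⟨hint _ ?_, ?_⟩⟩
  -- Pairing the resolvent equation with an eigenvector makes it scalar.
  · have hc : ∀ i, inner ℂ (e i) ω = (z - (l i : ℂ)) * inner ℂ (e i) ψ := fun i => by
      rw [← h, inner_sub_right, inner_smul_right, ← hT, hTe, inner_smul_left, Complex.conj_ofReal]
      ring
    have hG : cauchyTransform ⟨m, hm⟩ z = ∑ i, ‖inner ℂ (e i) ω‖ ^ 2 • (z - (l i : ℂ))⁻¹ :=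
      hval _ (Measurable.stronglyMeasurable (by fun_prop))
    rw [hG, ← e.sum_inner_mul_inner ω ψ]
    refine Finset.sum_congr rfl fun i _ => ?_
    have hn := sub_ofReal_ne_zero hz (l i)
    rw [← inner_conj_symm, Complex.real_smul, Complex.ofReal_pow, ← Complex.conj_mul']
    rw [mul_assoc]
    congr 1
    rw [hc i]
    field_simp
  · exact Continuous.stronglyMeasurable (by fun_prop)
  · rw [ProbabilityMeasure.coe_mk, hval _ (Continuous.stronglyMeasurable (by fun_prop)), ← hsum]
    refine Finset.sum_congr rfl fun i _ => ?_
    rw [inner_sub_right, inner_smul_right, ← hT, hTe, inner_smul_left, Complex.conj_ofReal,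
      ← sub_mul, norm_mul, ← Complex.ofReal_sub, Complex.norm_real, mul_pow, Real.norm_eq_abs,
      sq_abs, smul_eq_mul, mul_comm]

theorem integral_simpleFunc_comp {F : Type*} [NormedAddCommGroup F] [NormedSpace ℝ F]
    [CompleteSpace F] (μ : ProbabilityMeasure ℝ) (φ : SimpleFunc ℝ ℝ) (g : ℝ → F) :
    ∫ t, g (φ t) ∂(μ : Measure ℝ)
      = ∑ x : φ.range, (μ : Measure ℝ).real (φ ⁻¹' {(x : ℝ)}) • g x := by
  have h : (fun t => g (φ t))
      = fun t => ∑ x : φ.range, (φ ⁻¹' {(x : ℝ)}).indicator (fun _ => g x) t := by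
    funext t
    rw [Finset.sum_eq_single ⟨φ t, φ.mem_range_self t⟩]
    · simp
    · intro x _ hx
      refine Set.indicator_of_notMem (fun h => hx ?_) _
      exact Subtype.ext h.symm
    · simp
  rw [h, integral_finsetSum _ fun x _ =>
    (integrable_const _).indicator (φ.measurableSet_preimage _)]
  refine Finset.sum_congr rfl fun x _ => ?_
  rw [integral_indicator_const _ (φ.measurableSet_preimage _)]

/-- Monotone convolution of two finitely supported laws, realized by a matrix. -/
theorem exists_finite_monotoneConvolution {ι κ : Type*} [Fintype ι] [Fintype κ]
    {p x : ι → ℝ} {q y : κ → ℝ} (hp : ∀ i, 0 ≤ p i) (hq : ∀ j, 0 ≤ q j)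
    (hp1 : ∑ i, p i = 1) (hq1 : ∑ j, q j = 1) :
    ∃ ρ : ProbabilityMeasure ℝ,
      (∀ z F : ℂ, 0 < z.im → 0 < F.im → F * ∑ j, q j • (z - (y j : ℂ))⁻¹ = 1 →
        cauchyTransform ρ z = ∑ i, p i • (F - (x i : ℂ))⁻¹) ∧
      ∀ c : ℝ, Integrable (fun t : ℝ => (t - c) ^ 2) (ρ : Measure ℝ) ∧
        ∫ t, (t - c) ^ 2 ∂(ρ : Measure ℝ) = ∑ i, p i * ∑ j, q j * (x i + y j - c) ^ 2 := by
  classical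
  -- `X + Y` in the basis of normalized indicators of points: the projection onto constants has
  -- entries `√q_j √q_j'`, and `ω` below is the vacuum. No weight is divided by, so zero weights are
  -- harmless.
  obtain ⟨A, hAapp⟩ : ∃ A : Matrix (ι × κ) (ι × κ) ℂ, ∀ a b, A a b =
      (if a.1 = b.1 then ((x a.1 * (√(q a.2) * √(q b.2)) : ℝ) : ℂ) else 0)
        + if a = b then ((y a.2 : ℝ) : ℂ) else 0 := ⟨Matrix.of fun a b => _, fun _ _ => rfl⟩
  have hA : A.IsHermitian := by
    ext ⟨i, j⟩ ⟨i', j'⟩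
    rw [Matrix.conjTranspose_apply, hAapp, hAapp]
    by_cases h : i = i'
    · subst h
      by_cases h2 : j = j'
      · subst h2
        simp
      · simp [h2, Ne.symm h2, mul_comm]
    · simp [h, Ne.symm h]
  let T := A.toEuclideanLin
  have hT : T.IsSymmetric := Matrix.isSymmetric_toEuclideanLin_iff.2 hA
  have hTapp : ∀ (ψ : EuclideanSpace ℂ (ι × κ)) (i : ι) (j : κ), T ψ (i, j)
      = x i * √(q j) * ∑ j', √(q j') * ψ (i, j') + y j * ψ (i, j) := by
    intro ψ i j
    simp only [T, Matrix.toLpLin_apply, Matrix.mulVec, hAapp, dotProduct, add_mul,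
      Finset.sum_add_distrib, ite_mul, zero_mul, Finset.sum_ite_eq, Finset.mem_univ, if_true,
      Fintype.sum_prod_type]
    congr 1
    rw [Finset.sum_eq_single i]
    · simp only [if_true, Finset.mul_sum, Complex.ofReal_mul]
      exact Finset.sum_congr rfl fun j' _ => by ring
    · intro b _ hb
      simp [Ne.symm hb]
    · simp
  let ω : EuclideanSpace ℂ (ι × κ) := WithLp.toLp 2 fun a => ((√(p a.1) * √(q a.2) : ℝ) : ℂ)
  have hωapp : ∀ i j, ω (i, j) = ((√(p i) * √(q j) : ℝ) : ℂ) := fun _ _ => rfl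
  have hsp : ∀ i, √(p i) * √(p i) = p i := fun i => Real.mul_self_sqrt (hp i)
  have hsq : ∀ j, √(q j) * √(q j) = q j := fun j => Real.mul_self_sqrt (hq j)
  have hsq' : ∀ j, (√(q j) : ℂ) * √(q j) = q j := fun j => by
    rw [← Complex.ofReal_mul, hsq]
  have hsp' : ∀ i, (√(p i) : ℂ) * √(p i) = p i := fun i => by
    rw [← Complex.ofReal_mul, hsp]
  have hq1' : ∑ j, (q j : ℂ) = 1 := by rw [← Complex.ofReal_sum, hq1, Complex.ofReal_one]
  have hω : ‖ω‖ = 1 := by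
    rw [← sq_eq_sq₀ (norm_nonneg _) zero_le_one, EuclideanSpace.norm_sq_eq, Fintype.sum_prod_type]
    simp only [hωapp, Complex.norm_real, Real.norm_eq_abs, sq_abs, mul_pow,
      Real.sq_sqrt (hp _), Real.sq_sqrt (hq _), ← Finset.mul_sum, hp1, hq1, mul_one, one_pow]
  obtain ⟨ρ, hρ, hρ2⟩ := exists_distribution_of_isSymmetric hT hω
  refine ⟨ρ, fun z F hz hF hFG => ?_, fun c => ⟨(hρ2 c).1, (hρ2 c).2.trans ?_⟩⟩
  -- The explicit resolvent vector: for fixed `i` the equation makes `ψ` a multiple of `(z -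
  -- y_j)⁻¹`, and the relation between `F` and `z` fixes the factor.
  · let ψ : EuclideanSpace ℂ (ι × κ) := WithLp.toLp 2 fun a =>
      √(p a.1) * √(q a.2) * F * (F - (x a.1 : ℂ))⁻¹ * (z - (y a.2 : ℂ))⁻¹
    have hψapp : ∀ i j, ψ (i, j)
      = √(p i) * √(q j) * F * (F - (x i : ℂ))⁻¹ * (z - (y j : ℂ))⁻¹ := fun _ _ => rfl
    have hs : ∀ i, ∑ j, √(q j) * ψ (i, j) = √(p i) * (F - (x i : ℂ))⁻¹ := by
      intro i
      rw [← mul_one (√(p i) * (F - (x i : ℂ))⁻¹), ← hFG, Finset.mul_sum, Finset.mul_sum]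
      refine Finset.sum_congr rfl fun j _ => ?_
      rw [hψapp, Complex.real_smul, ← hsq']
      ring
    rw [← hρ z ψ hz]
    · rw [PiLp.inner_apply, Fintype.sum_prod_type]
      refine Finset.sum_congr rfl fun i _ => ?_
      rw [Complex.real_smul, ← hsp', mul_assoc, ← hs, Finset.mul_sum]
      refine Finset.sum_congr rfl fun j _ => ?_
      rw [hωapp, RCLike.inner_apply, Complex.conj_ofReal, Complex.ofReal_mul]
      ring
    · ext ⟨i, j⟩
      rw [PiLp.sub_apply, PiLp.smul_apply, hTapp, hs, hωapp, hψapp]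
      have n1 := sub_ofReal_ne_zero hF (x i)
      have n2 := sub_ofReal_ne_zero hz (y j)
      rw [smul_eq_mul, Complex.ofReal_mul]
      field_simp
      ring
  · rw [EuclideanSpace.norm_sq_eq, Fintype.sum_prod_type]
    refine Finset.sum_congr rfl fun i _ => ?_
    rw [Finset.mul_sum]
    refine Finset.sum_congr rfl fun j _ => ?_
    have hs : ∑ j, (√(q j) : ℂ) * ω (i, j) = √(p i) := by
      rw [← mul_one (√(p i) : ℂ), ← hq1', Finset.mul_sum]
      refine Finset.sum_congr rfl fun j _ => ?_
      rw [hωapp, ← hsq', Complex.ofReal_mul]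
      ring
    have : (T ω - (c : ℂ) • ω) (i, j) = ((√(p i) * √(q j) * (x i + y j - c) : ℝ) : ℂ) := by
      rw [PiLp.sub_apply, PiLp.smul_apply, hTapp, hs, hωapp, smul_eq_mul]
      push_cast
      ring
    rw [this, Complex.norm_real, Real.norm_eq_abs, sq_abs, mul_pow, mul_pow,
      Real.sq_sqrt (hp _), Real.sq_sqrt (hq _), mul_assoc]

/-! ### Monotone convolution of simple images -/

theorem cauchyTransform_map (μ : ProbabilityMeasure ℝ) {f : ℝ → ℝ} (hf : Measurable f) (z : ℂ) :
    cauchyTransform (μ.map hf.aemeasurable) z = ∫ t, (z - (f t : ℂ))⁻¹ ∂(μ : Measure ℝ) := by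
  rw [cauchyTransform, ProbabilityMeasure.toMeasure_map, integral_map hf.aemeasurable]
  exact Measurable.aestronglyMeasurable (by fun_prop)

theorem cauchyTransform_ne_zero (μ : ProbabilityMeasure ℝ) {z : ℂ} (hz : 0 < z.im) :
    cauchyTransform μ z ≠ 0 := fun h => by
  have := cauchyTransform_im_neg μ hz
  simp [h] at this

theorem isMonotoneConvolution_iff_cauchyTransform (μ ν ρ : ProbabilityMeasure ℝ) :
    IsMonotoneConvolution μ ν ρ ↔ ∀ z : ℂ, 0 < z.im →
      cauchyTransform ρ z = cauchyTransform μ (reciprocalCauchyTransform ν z) := by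
  rw [isMonotoneConvolution_iff]
  exact forall₂_congr fun z _ => inv_inj

theorem integrable_simpleFunc_add_sub_sq (μ ν : ProbabilityMeasure ℝ) (φ χ : SimpleFunc ℝ ℝ)
    (c : ℝ) : Integrable (fun s : ℝ × ℝ => (φ s.1 + χ s.2 - c) ^ 2)
      ((μ : Measure ℝ).prod (ν : Measure ℝ)) := by
  have h1 : MemLp (fun s : ℝ × ℝ => φ s.1) 2 ((μ : Measure ℝ).prod (ν : Measure ℝ)) :=
    (φ.memLp_of_isFiniteMeasure 2 (μ : Measure ℝ)).comp_fst (ν : Measure ℝ)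
  have h2 : MemLp (fun s : ℝ × ℝ => χ s.2) 2 ((μ : Measure ℝ).prod (ν : Measure ℝ)) :=
    (χ.memLp_of_isFiniteMeasure 2 (ν : Measure ℝ)).comp_snd (μ : Measure ℝ)
  exact ((h1.add h2).sub (memLp_const c)).integrable_sq

theorem exists_isMonotoneConvolution_map_simpleFunc (μ ν : ProbabilityMeasure ℝ)
    (φ χ : SimpleFunc ℝ ℝ) :
    ∃ ρ : ProbabilityMeasure ℝ,
      IsMonotoneConvolution (μ.map φ.measurable.aemeasurable) (ν.map χ.measurable.aemeasurable) ρ ∧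
      ∀ c : ℝ, Integrable (fun t : ℝ => (t - c) ^ 2) (ρ : Measure ℝ) ∧
        ∫ t, (t - c) ^ 2 ∂(ρ : Measure ℝ)
          = ∫ s, (φ s.1 + χ s.2 - c) ^ 2 ∂(μ : Measure ℝ).prod (ν : Measure ℝ) := by
  have hone : ∀ (μ : ProbabilityMeasure ℝ) (φ : SimpleFunc ℝ ℝ),
      ∑ x : φ.range, (μ : Measure ℝ).real (φ ⁻¹' {(x : ℝ)}) = 1 := fun μ φ => by
    simpa using (integral_simpleFunc_comp μ φ (fun _ => (1 : ℝ))).symm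
  obtain ⟨ρ, h1, h2⟩ := exists_finite_monotoneConvolution
    (p := fun x : φ.range => (μ : Measure ℝ).real (φ ⁻¹' {(x : ℝ)})) (x := fun x => (x : ℝ))
    (q := fun y : χ.range => (ν : Measure ℝ).real (χ ⁻¹' {(y : ℝ)})) (y := fun y => (y : ℝ))
    (fun _ => measureReal_nonneg) (fun _ => measureReal_nonneg) (hone μ φ) (hone ν χ)
  refine ⟨ρ, ?_, fun c => ⟨(h2 c).1, (h2 c).2.trans ?_⟩⟩
  · rw [isMonotoneConvolution_iff_cauchyTransform]
    intro z hz
    rw [cauchyTransform_map μ φ.measurable, integral_simpleFunc_comp μ φ (fun x => (_ - (x : ℂ))⁻¹)]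
    refine h1 z _ hz (reciprocalCauchyTransform_im_pos _ hz) ?_
    rw [← integral_simpleFunc_comp ν χ (fun y => (z - (y : ℂ))⁻¹),
      ← cauchyTransform_map ν χ.measurable]
    exact inv_mul_cancel₀ (cauchyTransform_ne_zero _ hz)
  · rw [integral_prod _ (integrable_simpleFunc_add_sub_sq μ ν φ χ c),
      integral_simpleFunc_comp μ φ (fun x => ∫ y, (x + χ y - c) ^ 2 ∂(ν : Measure ℝ))]
    refine Finset.sum_congr rfl fun x _ => ?_
    rw [integral_simpleFunc_comp ν χ (fun y => ((x : ℝ) + y - c) ^ 2)]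
    rfl

/-! ### Second moments from the Cauchy transform -/

/-- A regularized second moment about `c`, read off from the Cauchy transform. -/
theorem sq_mul_one_add_im_cauchyTransform (ρ : ProbabilityMeasure ℝ) (c : ℝ) {y : ℝ} (hy : 0 < y) :
    y ^ 2 * (1 + y * (cauchyTransform ρ ⟨c, y⟩).im)
      = ∫ t, y ^ 2 * (t - c) ^ 2 / ((t - c) ^ 2 + y ^ 2) ∂(ρ : Measure ℝ) := by
  have hi := integrable_inv_sub_ofReal ρ (z := ⟨c, y⟩) hy
  have h : (cauchyTransform ρ ⟨c, y⟩).im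
      = ∫ t, (((⟨c, y⟩ : ℂ) - (t : ℂ))⁻¹).im ∂(ρ : Measure ℝ) := (integral_im hi).symm
  have h1 : (1 : ℝ) = ∫ _, 1 ∂(ρ : Measure ℝ) := by simp
  have hi' : Integrable (fun t : ℝ => y * (((⟨c, y⟩ : ℂ) - (t : ℂ))⁻¹).im) (ρ : Measure ℝ) :=
    hi.im.const_mul y
  rw [h, ← integral_const_mul, h1, ← integral_add (integrable_const _) hi', ← integral_const_mul]
  refine integral_congr_ae (ae_of_all _ fun t => ?_)
  have : (t - c) ^ 2 + y ^ 2 ≠ 0 := by positivity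
  simp only [Complex.inv_im, Complex.normSq_apply, Complex.sub_re, Complex.sub_im,
    Complex.ofReal_re, Complex.ofReal_im, sub_zero]
  rw [show (c - t) * (c - t) + y * y = (t - c) ^ 2 + y ^ 2 by ring]
  field_simp
  ring

theorem sq_mul_one_add_im_cauchyTransform_le (ρ : ProbabilityMeasure ℝ) (c : ℝ) {y : ℝ}
    (hy : 0 < y) (h : Integrable (fun t : ℝ => (t - c) ^ 2) (ρ : Measure ℝ)) :
    y ^ 2 * (1 + y * (cauchyTransform ρ ⟨c, y⟩).im) ≤ ∫ t, (t - c) ^ 2 ∂(ρ : Measure ℝ) := by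
  rw [sq_mul_one_add_im_cauchyTransform ρ c hy]
  refine integral_mono_of_nonneg (ae_of_all _ fun t => ?_) h (ae_of_all _ fun t => ?_)
  · simp only [Pi.zero_apply]
    positivity
  · simp only
    rw [div_le_iff₀ (by positivity)]
    nlinarith [sq_nonneg ((t - c) ^ 2)]

/-- The regularized integrand tends to `(t - c)²` as `y → ∞`, so Fatou's lemma turns a bound uniform
in `y` into integrability together with the bound. -/
theorem second_moment_le_of_cauchyTransform (ρ : ProbabilityMeasure ℝ) (c V : ℝ)
    (h : ∀ y : ℝ, 0 < y → y ^ 2 * (1 + y * (cauchyTransform ρ ⟨c, y⟩).im) ≤ V) :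
    Integrable (fun t : ℝ => (t - c) ^ 2) (ρ : Measure ℝ) ∧
      ∫ t, (t - c) ^ 2 ∂(ρ : Measure ℝ) ≤ V := by
  -- The regularized integrand at height `y = n + 1`, which is positive for every `n`.
  let k : ℕ → ℝ → ℝ := fun n t =>
    ((n : ℝ) + 1) ^ 2 * (t - c) ^ 2 / ((t - c) ^ 2 + ((n : ℝ) + 1) ^ 2)
  have hk0 : ∀ n t, 0 ≤ k n t := fun n t => by positivity
  have hkm : ∀ n, Measurable (k n) := fun n => by fun_prop
  have hki : ∀ n, Integrable (k n) (ρ : Measure ℝ) := fun n => by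
    refine Integrable.of_bound (hkm n).aestronglyMeasurable (((n : ℝ) + 1) ^ 2)
      (ae_of_all _ fun t => ?_)
    rw [Real.norm_of_nonneg (hk0 n t), div_le_iff₀ (by positivity)]
    nlinarith [sq_nonneg (((n : ℝ) + 1) ^ 2)]
  have hlim : ∀ t, Tendsto (fun n => k n t) atTop (𝓝 ((t - c) ^ 2)) := fun t => by
    have h1 : Tendsto (fun n : ℕ => (t - c) ^ 2 / (((n : ℝ) + 1) ^ 2)) atTop (𝓝 0) := by
      refine Tendsto.const_div_atTop ?_ _
      exact (tendsto_pow_atTop two_ne_zero).comp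
        (tendsto_atTop_add_const_right _ _ tendsto_natCast_atTop_atTop)
    have h2 := (tendsto_const_nhds (x := (t - c) ^ 2)).div (h1.add_const 1) (by norm_num)
    rw [zero_add, div_one] at h2
    refine h2.congr fun n => ?_
    simp only [k, Pi.div_apply]
    have : ((n : ℝ) + 1) ^ 2 ≠ 0 := by positivity
    field_simp
  have hV : 0 ≤ V := by
    refine le_trans ?_ (h 1 one_pos)
    rw [sq_mul_one_add_im_cauchyTransform ρ c one_pos]
    exact integral_nonneg fun t => by positivity
  have hle : ∫⁻ t, ENNReal.ofReal ((t - c) ^ 2) ∂(ρ : Measure ℝ) ≤ ENNReal.ofReal V := by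
    calc ∫⁻ t, ENNReal.ofReal ((t - c) ^ 2) ∂(ρ : Measure ℝ)
        = ∫⁻ t, liminf (fun n => ENNReal.ofReal (k n t)) atTop ∂(ρ : Measure ℝ) := by
          refine lintegral_congr fun t => ?_
          exact (ENNReal.tendsto_ofReal (hlim t)).liminf_eq.symm
      _ ≤ liminf (fun n => ∫⁻ t, ENNReal.ofReal (k n t) ∂(ρ : Measure ℝ)) atTop :=
          lintegral_liminf_le fun n => (hkm n).ennreal_ofReal
      _ ≤ ENNReal.ofReal V := by
          refine liminf_le_of_le (by isBoundedDefault) fun b hb => ?_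
          obtain ⟨n, hn⟩ := hb.exists
          refine hn.trans ?_
          rw [← ofReal_integral_eq_lintegral_ofReal (hki n) (ae_of_all _ (hk0 n)),
            ← sq_mul_one_add_im_cauchyTransform ρ c (by positivity)]
          exact ENNReal.ofReal_le_ofReal (h _ (by positivity))
  have hint : Integrable (fun t : ℝ => (t - c) ^ 2) (ρ : Measure ℝ) := by
    refine ⟨by fun_prop, ?_⟩
    rw [hasFiniteIntegral_iff_ofReal (ae_of_all _ fun t => sq_nonneg _)]
    exact hle.trans_lt ENNReal.ofReal_lt_top
  refine ⟨hint, ?_⟩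
  rw [integral_eq_lintegral_of_nonneg_ae (ae_of_all _ fun t => sq_nonneg _)
    hint.aestronglyMeasurable]
  exact ENNReal.toReal_le_of_le_ofReal hV hle

theorem measure_abs_sub_ge_le (ρ : ProbabilityMeasure ℝ) {c V ε : ℝ} (hε : 0 < ε)
    (hi : Integrable (fun t : ℝ => (t - c) ^ 2) (ρ : Measure ℝ))
    (hV : ∫ t, (t - c) ^ 2 ∂(ρ : Measure ℝ) ≤ V) :
    (ρ : Measure ℝ) {t : ℝ | ε ≤ |t - c|} ≤ ENNReal.ofReal (V / ε ^ 2) := by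
  have hset : {t : ℝ | ε ≤ |t - c|} = {t | ε ^ 2 ≤ (t - c) ^ 2} := by
    ext t
    rw [Set.mem_ofPred_eq, Set.mem_ofPred_eq, ← sq_abs (t - c), sq_le_sq₀ hε.le (abs_nonneg _)]
  rw [hset, ← ofReal_measureReal (measure_ne_top _ _)]
  refine ENNReal.ofReal_le_ofReal ?_
  rw [le_div_iff₀ (by positivity), mul_comm]
  exact (mul_meas_ge_le_integral_of_nonneg (ae_of_all _ fun t => sq_nonneg _) hi _).trans hV

/-! ### Limits and tightness -/

/-- The argument `w n` varies because the outer transform in `G_μ ∘ F_ν` is evaluated at a point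
that depends on the discretization of `ν`. -/
theorem tendsto_cauchyTransform_map (μ : ProbabilityMeasure ℝ) {f : ℕ → ℝ → ℝ}
    (hf : ∀ n, Measurable (f n)) (hlim : ∀ t, Tendsto (fun n => f n t) atTop (𝓝 t))
    {w : ℕ → ℂ} {z : ℂ} (hz : 0 < z.im) (hw : Tendsto w atTop (𝓝 z)) :
    Tendsto (fun n => cauchyTransform (μ.map (hf n).aemeasurable) (w n)) atTop
      (𝓝 (cauchyTransform μ z)) := by
  simp_rw [cauchyTransform_map μ (hf _)]
  -- Staying at height above `Im z / 2` bounds the integrands by one constant.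
  have him : ∀ᶠ n in atTop, z.im / 2 < (w n).im :=
    ((Complex.continuous_im.tendsto z).comp hw).eventually (lt_mem_nhds (by linarith))
  refine tendsto_integral_filter_of_dominated_convergence (fun _ => (z.im / 2)⁻¹)
    (Eventually.of_forall fun n => ?_) ?_ (integrable_const _) (ae_of_all _ fun t => ?_)
  · have := hf n
    exact Measurable.aestronglyMeasurable (by fun_prop)
  · filter_upwards [him] with n hn
    refine ae_of_all _ fun t => ?_
    exact (norm_inv_sub_ofReal_le ((half_pos hz).trans hn) _).trans
      (inv_anti₀ (half_pos hz) hn.le)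
  · refine Tendsto.inv₀ (hw.sub ?_) (sub_ofReal_ne_zero hz t)
    exact (Complex.continuous_ofReal.tendsto t).comp (hlim t)

theorem tendsto_cauchyTransform {α : Type*} {l : Filter α} {ρs : α → ProbabilityMeasure ℝ}
    {ρ : ProbabilityMeasure ℝ} (h : Tendsto ρs l (𝓝 ρ)) {z : ℂ} (hz : 0 < z.im) :
    Tendsto (fun n => cauchyTransform (ρs n) z) l (𝓝 (cauchyTransform ρ z)) := by
  have hc : Continuous fun t : ℝ => (z - (t : ℂ))⁻¹ :=
    Continuous.inv₀ (by fun_prop) (sub_ofReal_ne_zero hz)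
  exact (ProbabilityMeasure.tendsto_iff_forall_integral_rclike_tendsto ℂ).1 h
    (BoundedContinuousFunction.ofNormedAddCommGroup _ hc _ (norm_inv_sub_ofReal_le hz))

theorem isTightMeasureSet_of_second_moment_le {S : Set (ProbabilityMeasure ℝ)} {C : ℝ}
    (h : ∀ ρ ∈ S, Integrable (fun t : ℝ => t ^ 2) (ρ : Measure ℝ) ∧
      ∫ t, t ^ 2 ∂(ρ : Measure ℝ) ≤ C) :
    IsTightMeasureSet {m : Measure ℝ | ∃ ρ ∈ S, (ρ : Measure ℝ) = m} := by
  rw [isTightMeasureSet_iff_tendsto_measure_norm_gt]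
  have hlim : Tendsto (fun r : ℝ => ENNReal.ofReal (C / r ^ 2)) atTop (𝓝 0) := by
    rw [← ENNReal.ofReal_zero]
    exact ENNReal.tendsto_ofReal (Tendsto.const_div_atTop (tendsto_pow_atTop two_ne_zero) C)
  refine tendsto_of_tendsto_of_tendsto_of_le_of_le' tendsto_const_nhds hlim
    (Eventually.of_forall fun _ => zero_le) ?_
  filter_upwards [eventually_gt_atTop 0] with r hr
  refine iSup₂_le ?_
  rintro _ ⟨ρ, hρ, rfl⟩
  refine (measure_mono ?_).trans (measure_abs_sub_ge_le ρ (c := 0) hr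
    (by simpa using (h ρ hρ).1) (by simpa using (h ρ hρ).2))
  intro t ht
  simpa using (le_of_lt ht : r ≤ ‖t‖)

/-- Simple functions that approximate the identity of `ℝ`. -/
def approxId (n : ℕ) : SimpleFunc ℝ ℝ :=
  SimpleFunc.approxOn id measurable_id Set.univ 0 (Set.mem_univ 0) n

theorem tendsto_approxId (t : ℝ) : Tendsto (fun n => approxId n t) atTop (𝓝 t) :=
  SimpleFunc.tendsto_approxOn measurable_id (Set.mem_univ 0) (by simp)

/-- Provides the square-integrable majorant for the dominated convergence of second moments. -/
theorem abs_approxId_le (n : ℕ) (t : ℝ) : |approxId n t| ≤ 2 * |t| := by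
  rw [two_mul]
  exact SimpleFunc.norm_approxOn_zero_le measurable_id (Set.mem_univ 0) t n

theorem tendsto_second_moment_approxId {μ ν : ProbabilityMeasure ℝ}
    (hμ : MemLp (fun t : ℝ => t) 2 (μ : Measure ℝ)) (hν : MemLp (fun t : ℝ => t) 2 (ν : Measure ℝ))
    (c : ℝ) :
    Tendsto (fun n => ∫ s, (approxId n s.1 + approxId n s.2 - c) ^ 2
        ∂(μ : Measure ℝ).prod (ν : Measure ℝ)) atTop
      (𝓝 (∫ s, (s.1 + s.2 - c) ^ 2 ∂(μ : Measure ℝ).prod (ν : Measure ℝ))) := by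
  have hb : MemLp (fun s : ℝ × ℝ => 2 * ‖s.1‖ + 2 * ‖s.2‖ + |c|) 2
      ((μ : Measure ℝ).prod (ν : Measure ℝ)) :=
    (((hμ.comp_fst (ν : Measure ℝ)).norm.const_mul 2).add
      ((hν.comp_snd (μ : Measure ℝ)).norm.const_mul 2)).add (memLp_const |c|)
  refine tendsto_integral_of_dominated_convergence _
    (fun n => (integrable_simpleFunc_add_sub_sq μ ν _ _ c).aestronglyMeasurable) hb.integrable_sq
    (fun n => ae_of_all _ fun s => ?_) (ae_of_all _ fun s => ?_)
  · rw [Real.norm_of_nonneg (sq_nonneg _), ← sq_abs]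
    have h1 := abs_approxId_le n s.1
    have h2 := abs_approxId_le n s.2
    have h3 := abs_sub (approxId n s.1 + approxId n s.2) c
    have h4 := abs_add_le (approxId n s.1) (approxId n s.2)
    have h5 : |approxId n s.1 + approxId n s.2 - c| ≤ 2 * ‖s.1‖ + 2 * ‖s.2‖ + |c| := by
      simp only [Real.norm_eq_abs]
      linarith
    gcongr
  · exact (((tendsto_approxId s.1).add (tendsto_approxId s.2)).sub_const c).pow 2

/-- The monotone convolutions of the discretized measures converge to that of the measures. -/
theorem tendsto_cauchyTransform_approxId {μ ν : ProbabilityMeasure ℝ}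
    {ρs : ℕ → ProbabilityMeasure ℝ}
    (hρs : ∀ n, IsMonotoneConvolution (μ.map (approxId n).measurable.aemeasurable)
      (ν.map (approxId n).measurable.aemeasurable) (ρs n)) {z : ℂ} (hz : 0 < z.im) :
    Tendsto (fun n => cauchyTransform (ρs n) z) atTop
      (𝓝 (cauchyTransform μ (reciprocalCauchyTransform ν z))) := by
  simp_rw [fun n => (isMonotoneConvolution_iff_cauchyTransform _ _ _).1 (hρs n) z hz]
  refine tendsto_cauchyTransform_map μ (fun n => (approxId n).measurable) tendsto_approxId
    (reciprocalCauchyTransform_im_pos ν hz) ?_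
  exact (tendsto_cauchyTransform_map ν (fun n => (approxId n).measurable) tendsto_approxId hz
    tendsto_const_nhds).inv₀ (cauchyTransform_ne_zero ν hz)

/-! ### Existence and second moments of the convolution -/

/-- The discretized convolutions have bounded second moments, hence are tight. By Prokhorov's
theorem they have a limit point, whose Cauchy transform must be `G_μ ∘ F_ν`. -/
theorem exists_isMonotoneConvolution {μ ν : ProbabilityMeasure ℝ}
    (hμ : MemLp (fun t : ℝ => t) 2 (μ : Measure ℝ))
    (hν : MemLp (fun t : ℝ => t) 2 (ν : Measure ℝ)) :
    ∃ ρ : ProbabilityMeasure ℝ, IsMonotoneConvolution μ ν ρ := by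
  choose ρs hρs hmom using fun n =>
    exists_isMonotoneConvolution_map_simpleFunc μ ν (approxId n) (approxId n)
  obtain ⟨C, hC⟩ := (tendsto_second_moment_approxId hμ hν 0).bddAbove_range
  have htight := isTightMeasureSet_of_second_moment_le (S := Set.range ρs) (C := C) (by
    rintro _ ⟨n, rfl⟩
    have h := hmom n 0
    simp only [sub_zero] at h hC
    exact ⟨h.1, h.2.trans_le (hC ⟨n, rfl⟩)⟩)
  -- A limit along a free ultrafilter replaces the extraction of a subsequence.
  obtain ⟨ρ, -, hρ⟩ := (isCompact_closure_of_isTightMeasureSet htight).ultrafilter_le_nhds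
    ((hyperfilter ℕ).map ρs) (le_principal_iff.2 (Filter.mem_map.2
      (Filter.univ_mem' fun n => subset_closure ⟨n, rfl⟩)))
  have hlim : Tendsto ρs (hyperfilter ℕ) (𝓝 ρ) := hρ
  refine ⟨ρ, (isMonotoneConvolution_iff_cauchyTransform _ _ _).2 fun z hz => ?_⟩
  exact tendsto_nhds_unique (tendsto_cauchyTransform hlim hz)
    ((tendsto_cauchyTransform_approxId hρs hz).mono_left Nat.hyperfilter_le_atTop)

/-- At each fixed height `y` the regularized moment of the discretized law is at most its exact
second moment. Letting `n → ∞` first gives a bound independent of `y`. Only transforms are compared,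
so weak convergence to `ρ` is not needed. -/
theorem IsMonotoneConvolution.second_moment_le {μ ν ρ : ProbabilityMeasure ℝ}
    (h : IsMonotoneConvolution μ ν ρ) (hμ : MemLp (fun t : ℝ => t) 2 (μ : Measure ℝ))
    (hν : MemLp (fun t : ℝ => t) 2 (ν : Measure ℝ)) (c : ℝ) :
    Integrable (fun t : ℝ => (t - c) ^ 2) (ρ : Measure ℝ) ∧
      ∫ t, (t - c) ^ 2 ∂(ρ : Measure ℝ)
        ≤ ∫ s, (s.1 + s.2 - c) ^ 2 ∂(μ : Measure ℝ).prod (ν : Measure ℝ) := by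
  choose ρs hρs hmom using fun n =>
    exists_isMonotoneConvolution_map_simpleFunc μ ν (approxId n) (approxId n)
  refine second_moment_le_of_cauchyTransform ρ c _ fun y hy => ?_
  rw [(isMonotoneConvolution_iff_cauchyTransform _ _ _).1 h ⟨c, y⟩ hy]
  have hG := tendsto_cauchyTransform_approxId hρs (z := ⟨c, y⟩) hy
  have hlim := ((((Complex.continuous_im.tendsto _).comp hG).const_mul y).const_add 1).const_mul
    (y ^ 2)
  refine le_of_tendsto_of_tendsto' hlim (tendsto_second_moment_approxId hμ hν c) fun n => ?_
  rw [← (hmom n c).2]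
  exact sq_mul_one_add_im_cauchyTransform_le _ c hy (hmom n c).1

theorem isMonotoneConvolution_monotoneConvolution {μ ν : ProbabilityMeasure ℝ}
    (hμ : MemLp (fun t : ℝ => t) 2 (μ : Measure ℝ))
    (hν : MemLp (fun t : ℝ => t) 2 (ν : Measure ℝ)) :
    IsMonotoneConvolution μ ν (monotoneConvolution μ ν) :=
  Classical.epsilon_spec (exists_isMonotoneConvolution hμ hν)

theorem memLp_monotoneConvolution {μ ν : ProbabilityMeasure ℝ}
    (hμ : MemLp (fun t : ℝ => t) 2 (μ : Measure ℝ))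
    (hν : MemLp (fun t : ℝ => t) 2 (ν : Measure ℝ)) :
    MemLp (fun t : ℝ => t) 2 (monotoneConvolution μ ν : Measure ℝ) := by
  have h := ((isMonotoneConvolution_monotoneConvolution hμ hν).second_moment_le hμ hν 0).1
  rw [memLp_two_iff_integrable_sq (by fun_prop)]
  simpa using h

/-! ### Addition of variances -/

/-- The cross term vanishes because `s.2 - m` has mean zero under `ν`. The centre `c` need not be
the mean of `μ`, so the induction never computes the mean of a convolution. -/
theorem integral_add_sub_sq_prod {μ ν : ProbabilityMeasure ℝ}
    (hμ : MemLp (fun t : ℝ => t) 2 (μ : Measure ℝ))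
    (hν : MemLp (fun t : ℝ => t) 2 (ν : Measure ℝ)) (c : ℝ) :
    ∫ s, (s.1 + s.2 - (c + ∫ t, t ∂(ν : Measure ℝ))) ^ 2 ∂(μ : Measure ℝ).prod (ν : Measure ℝ)
      = ∫ t, (t - c) ^ 2 ∂(μ : Measure ℝ) + variance (fun t : ℝ => t) (ν : Measure ℝ) := by
  set m : ℝ := ∫ t, t ∂(ν : Measure ℝ) with hm
  have h1 : MemLp (fun t : ℝ => t - c) 2 (μ : Measure ℝ) := hμ.sub (memLp_const c)
  have h2 : MemLp (fun t : ℝ => t - m) 2 (ν : Measure ℝ) := hν.sub (memLp_const m)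
  have i1 : Integrable (fun s : ℝ × ℝ => (s.1 - c) ^ 2) ((μ : Measure ℝ).prod (ν : Measure ℝ)) :=
    h1.integrable_sq.comp_fst (ν : Measure ℝ)
  have i2 : Integrable (fun s : ℝ × ℝ => (s.2 - m) ^ 2) ((μ : Measure ℝ).prod (ν : Measure ℝ)) :=
    h2.integrable_sq.comp_snd (μ : Measure ℝ)
  have i3 : Integrable (fun s : ℝ × ℝ => (s.1 - c) * (s.2 - m))
      ((μ : Measure ℝ).prod (ν : Measure ℝ)) :=
    (h1.integrable (by norm_num)).mul_prod (h2.integrable (by norm_num))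
  have i12 : Integrable (fun s : ℝ × ℝ => (s.1 - c) ^ 2 + (s.2 - m) ^ 2)
      ((μ : Measure ℝ).prod (ν : Measure ℝ)) := i1.add i2
  have h0 : ∫ t, (t - m) ∂(ν : Measure ℝ) = 0 := by
    rw [integral_sub (hν.integrable (by norm_num)) (integrable_const m), ← hm]
    simp
  have e : ∀ s : ℝ × ℝ, (s.1 + s.2 - (c + m)) ^ 2
      = (s.1 - c) ^ 2 + (s.2 - m) ^ 2 + 2 * ((s.1 - c) * (s.2 - m)) := fun s => by ring
  simp_rw [e]
  rw [integral_add i12 (i3.const_mul 2), integral_add i1 i2, integral_const_mul,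
    integral_prod_mul (fun t : ℝ => t - c) (fun t : ℝ => t - m), h0, mul_zero, mul_zero, add_zero,
    integral_fun_fst (fun t : ℝ => (t - c) ^ 2), integral_fun_snd (fun t : ℝ => (t - m) ^ 2),
    variance_eq_integral (by fun_prop), ← hm]
  simp

theorem memLp_iteratedMonotoneConvolution {μ : ℕ → ProbabilityMeasure ℝ}
    (hμ : ∀ n, MemLp (fun t : ℝ => t) 2 (μ n : Measure ℝ)) (n : ℕ) :
    MemLp (fun t : ℝ => t) 2 (iteratedMonotoneConvolution μ n : Measure ℝ) := by
  induction n with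
  | zero => exact hμ 0
  | succ n ih => exact memLp_monotoneConvolution ih (hμ (n + 1))

theorem second_moment_iteratedMonotoneConvolution_le {μ : ℕ → ProbabilityMeasure ℝ}
    (hμ : ∀ n, MemLp (fun t : ℝ => t) 2 (μ n : Measure ℝ)) (n : ℕ) :
    ∫ t, (t - ∑ k ∈ Finset.range (n + 1), ∫ s, s ∂(μ k : Measure ℝ)) ^ 2
        ∂(iteratedMonotoneConvolution μ n : Measure ℝ)
      ≤ ∑ k ∈ Finset.range (n + 1), variance (fun t : ℝ => t) (μ k : Measure ℝ) := by
  induction n with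
  | zero =>
    simp only [zero_add, Finset.range_one, Finset.sum_singleton]
    rw [variance_eq_integral (by fun_prop)]
    rfl
  | succ n ih =>
    have hn := memLp_iteratedMonotoneConvolution hμ n
    rw [Finset.sum_range_succ, Finset.sum_range_succ _ (n + 1)]
    -- The new measure is the right factor, so the centre splits as the previous sum plus its mean.
    refine ((isMonotoneConvolution_monotoneConvolution hn (hμ (n + 1))).second_moment_le hn
      (hμ (n + 1)) _).2.trans ?_
    rw [integral_add_sub_sq_prod hn (hμ (n + 1))]
    gcongr

/-! ### Weighted averages and stability -/

/-- A case of the lemma of Kronecker on weighted averages. -/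
theorem tendsto_sum_div_sq {v b : ℕ → ℝ} (hv : ∀ k, 0 ≤ v k) (hb : ∀ k, 0 < b k)
    (hmono : Monotone b) (hlim : Tendsto b atTop atTop)
    (hsum : Summable fun k => v k / b k ^ 2) :
    Tendsto (fun n => (∑ k ∈ Finset.range (n + 1), v k) / b n ^ 2) atTop (𝓝 0) := by
  let f : ℕ → ℕ → ℝ := fun n k => if k ∈ Finset.range (n + 1) then v k / b n ^ 2 else 0
  have hf : Tendsto (fun n => ∑' k, f n k) atTop (𝓝 (∑' _ : ℕ, 0)) := by
    -- Each truncated term tends to `0` since `b n → ∞`, and is at most `v k / b k ^ 2` since `b k ≤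
    -- b n` for `k ≤ n`.
    refine tendsto_tsum_of_dominated_convergence hsum (fun k => ?_)
      (Eventually.of_forall fun n k => ?_)
    · have h0 : Tendsto (fun n => v k / b n ^ 2) atTop (𝓝 0) :=
        Tendsto.const_div_atTop ((tendsto_pow_atTop two_ne_zero).comp hlim) _
      refine h0.congr' ?_
      filter_upwards [eventually_ge_atTop k] with n hn
      simp only [f, if_pos (Finset.mem_range.2 (Nat.lt_succ_of_le hn))]
    · have hk := hb k
      have hn := hb n
      have hvk := hv k
      by_cases h : k ∈ Finset.range (n + 1)
      · simp only [f, if_pos h]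
        rw [Real.norm_of_nonneg (by positivity)]
        have := hmono (Nat.lt_succ_iff.1 (Finset.mem_range.1 h))
        gcongr
      · simp only [f, if_neg h, norm_zero]
        positivity
  rw [tsum_zero] at hf
  refine hf.congr fun n => ?_
  rw [tsum_eq_sum (s := Finset.range (n + 1)) (fun k hk => by simp only [f, if_neg hk]),
    Finset.sum_div]
  exact Finset.sum_congr rfl fun k hk => by simp only [f, if_pos hk]

theorem dilation_apply_abs_sub_ge (μ : ProbabilityMeasure ℝ) {b : ℝ} (hb : 0 < b) (c ε : ℝ) :
    (dilation (1 / b) μ : Measure ℝ) {t : ℝ | ε ≤ |t - 1 / b * c|}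
      = (μ : Measure ℝ) {t : ℝ | ε * b ≤ |t - c|} := by
  have hm : MeasurableSet {t : ℝ | ε ≤ |t - 1 / b * c|} :=
    measurableSet_le measurable_const (by fun_prop)
  rw [dilation, ProbabilityMeasure.toMeasure_map, Measure.map_apply (measurable_const_mul _) hm]
  congr 1
  ext t
  simp only [Set.mem_preimage, Set.mem_ofPred_eq]
  rw [← mul_sub, abs_mul, abs_of_pos (by positivity : 0 < 1 / b), one_div, inv_mul_eq_div,
    le_div_iff₀ hb]

theorem isStableWith_iteratedMonotoneConvolution {μ : ℕ → ProbabilityMeasure ℝ}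
    (hμ : ∀ n, MemLp (fun t : ℝ => t) 2 (μ n : Measure ℝ)) {b : ℕ → ℝ} (hb : ∀ n, 0 < b n)
    (hmono : Monotone b) (hlim : Tendsto b atTop atTop)
    (hsum : Summable fun k => variance (fun t : ℝ => t) (μ k : Measure ℝ) / b k ^ 2) :
    IsStableWith (fun n => dilation (1 / b n) (iteratedMonotoneConvolution μ n))
      (fun n => 1 / b n * ∑ k ∈ Finset.range (n + 1), ∫ t, t ∂(μ k : Measure ℝ)) := by
  intro ε hε
  have h0 := (tendsto_sum_div_sq (fun k => variance_nonneg _ _) hb hmono hlim hsum).div_const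
    (ε ^ 2)
  rw [zero_div] at h0
  have h1 := ENNReal.tendsto_ofReal h0
  rw [ENNReal.ofReal_zero] at h1
  refine tendsto_of_tendsto_of_tendsto_of_le_of_le tendsto_const_nhds h1
    (fun _ => zero_le) fun n => ?_
  simp only
  rw [dilation_apply_abs_sub_ge _ (hb n), div_div, mul_comm (b n ^ 2), ← mul_pow]
  have hn := memLp_iteratedMonotoneConvolution hμ n
  exact measure_abs_sub_ge_le _ (mul_pos hε (hb n)) (hn.sub (memLp_const _)).integrable_sq
    (second_moment_iteratedMonotoneConvolution_le hμ n)

/-- By the portmanteau criterion only open sets containing `m` matter; such a set contains a ball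
about `m`, whose complement has vanishing mass. -/
theorem IsStableWith.tendsto_diracProba {ν : ℕ → ProbabilityMeasure ℝ} {m : ℝ}
    (h : IsStableWith ν fun _ => m) : Tendsto ν atTop (𝓝 (diracProba m)) := by
  refine tendsto_of_forall_isOpen_le_liminf' fun G hG => ?_
  by_cases hm : m ∈ G
  · obtain ⟨ε, hε, hball⟩ := Metric.isOpen_iff.1 hG m hm
    have hlim : Tendsto (fun n => 1 - (ν n : Measure ℝ) {t : ℝ | ε ≤ |t - m|}) atTop
        (𝓝 (1 - 0)) := ENNReal.Tendsto.sub tendsto_const_nhds (h ε hε) (by simp)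
    refine prob_le_one.trans ?_
    rw [← tsub_zero (1 : ENNReal), ← hlim.liminf_eq]
    refine liminf_le_liminf (Eventually.of_forall fun n => ?_)
    rw [← prob_compl_eq_one_sub (measurableSet_le measurable_const (by fun_prop))]
    refine measure_mono fun t ht => hball ?_
    rw [Metric.mem_ball, Real.dist_eq]
    exact not_le.1 ht
  · have : (diracProba m : Measure ℝ) G = 0 := by
      rw [diracProba_toMeasure_apply' m hG.measurableSet]
      simp [hm]
    rw [this]
    exact zero_le

end

theorem theorem1p1 (μ : ℕ → ProbabilityMeasure ℝ)
    (hμ : ∀ n, MemLp (fun t : ℝ => t) 2 (μ n : Measure ℝ)) :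
    (∀ b : ℕ → ℝ, 0 < b 0 → StrictMono b → Tendsto b atTop atTop →
      Summable (fun k => variance (fun t : ℝ => t) (μ k : Measure ℝ) / b k ^ 2) →
      IsStableSequence (fun n => dilation (1 / b n) (iteratedMonotoneConvolution μ n)) ∧
      IsStableWith (fun n => dilation (1 / b n) (iteratedMonotoneConvolution μ n))
        (fun n => 1 / b n * ∑ k ∈ Finset.range (n + 1), ∫ t, t ∂(μ k : Measure ℝ))) ∧
    (∀ ν : ProbabilityMeasure ℝ, (∀ n, μ n = ν) →
      Tendsto (fun n : ℕ => dilation (1 / ((n : ℝ) + 1)) (iteratedMonotoneConvolution μ n)) atTop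
        (𝓝 (diracProba (∫ t, t ∂(ν : Measure ℝ))))) := by
  refine ⟨fun b hb0 hb hlim hsum => ?_, fun ν hν => ?_⟩
  · have hs := isStableWith_iteratedMonotoneConvolution hμ
      (fun n => hb0.trans_le (hb.monotone (Nat.zero_le n))) hb.monotone hlim hsum
    exact ⟨⟨_, hs⟩, hs⟩
  -- Index `n` stands for `n + 1` factors, hence the scale `n + 1`; the asymptotic constants
  -- collapse to the mean of `ν`.
  · have hs := isStableWith_iteratedMonotoneConvolution hμ (b := fun n => (n : ℝ) + 1)
      (fun n => by positivity) (fun i j hij => by simpa using hij)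
      (tendsto_atTop_add_const_right _ _ tendsto_natCast_atTop_atTop) (by
        simp_rw [hν, div_eq_mul_inv]
        refine Summable.mul_left _ ?_
        have h := (summable_nat_add_iff 1).2 (Real.summable_nat_pow_inv.2 one_lt_two)
        simpa using h)
    refine IsStableWith.tendsto_diracProba ?_
    convert hs using 2 with n
    rw [Finset.sum_congr rfl fun k _ => by rw [hν k], Finset.sum_const, Finset.card_range,
      nsmul_eq_mul, Nat.cast_add_one]
    field_simp
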